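/- Let $S_+$ be the group of bijections $w:\mathbb{Z}_+\to\mathbb{Z}_+$ with $w(k)=k$ for all but finitely many $k$, with multiplication given by composition, and let $S_n\subseteq S_+$ consist of the $w$ that fix every $k>n$. Cells $(i,j)\in\mathbb{Z}_+\times\mathbb{Z}_+$ are in matrix coordinates (row $i$ from the top, column $j$ from the left), and $t_{a,b}$ is the transposition of $a$ and $b$. *Pipe dreams.* A pipe dream of size $n$ is a subset $\mathcal P\subseteq\mathbb{T}_n=\{(i,j):i,j\ge 1,\ i+j\le n\}$ (its crossings). It stands for the tiling of the $n\times n$ grid with a crossing in each cell of $\mathcal P$, a bump (joining top edge to left edge and right edge to bottom edge) in each cell of $\mathbb{T}_n\setminus\mathcal P$, an elbow joining top edge to left edge in each cell with $i+j=n+1$, and blank tiles elsewhere. This gives $n$ pipes, which start at the top edge of the grid, travel south and west, and leave at the left edge. $\mathcal P$ is reduced if each pair of pipes crosses at most once. Its permutation $\delta(\mathcal P)\in S_n$ is obtained by labelling the pipes $1,\dots,n$ from left to right along the top edge and propagating the labels along the pipes, except that at every crossing the larger of the two incoming labels (from the top and from the right) leaves on the left and the smaller one leaves at the bottom; the labels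 on the left edge, read from top to bottom, are the one-line notation of $\delta(\mathcal P)$. For $w\in S_+$ let $\overline{\mathsf{Pipes}}(w)$ be the set of all pipe dreams $\mathcal P$, of any size $n$ such that $w\in S_n$, with $\delta(\mathcal P)=w$ (pipe dreams being identified with their sets of crossings), and let $\mathsf{Pipes}(w)$ be the subset of the reduced ones. *Dominant part.* The Rothe diagram of $w$ is $\mathrm{D}(w)=\{(i,j): j<w(i),\ i<w^{-1}(j)\}$, and $\mathrm{dom}(w)$ is the largest Young diagram $\mathbb{Y}_\lambda=\{(i,j): 1\le j\le\lambda_i\}$ of a (possibly empty) partition $\lambda$ that is contained in $\mathrm{D}(w)$. An addable cell of $\mathbb{Y}_\lambda$ is a cell $(i,j)\notin\mathbb{Y}_\lambda$ such that $(i-1,j)\in\mathbb{Y}_\lambda$ if $i>1$, and $(i,j-1)\in\mathbb{Y}_\lambda$ if $j>1$. *Co-transition sets.* A cell $(a,b)$ is a neighbor of $(i,j)$ in $w$ if $b=w(a)$, $i\le a$, $j\le b$, $(a,b)\ne(i,j)$, and no cell $(a',b')\in[i,a]\times[j,b]$ other than $(i,j)$ and $(a,b)$ satisfies $b'=w(a')$.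 Let $\phi_i(w)$ be the set of all $k$ such that $(k,w(k))$ is a neighbor of $(i,w(i))$, let $\Phi_i(w)=\{w\,t_{i,k}:k\in\phi_i(w)\}$, and let $$\overline{\Phi}_i(w)=\{w\,t_{i,i_k}t_{i,i_{k-1}}\cdots t_{i,i_1}:\emptyset\ne\{i_1<i_2<\cdots<i_k\}\subseteq\phi_i(w)\}.$$ **Proposition.** Let $w\in S_+$, and let $(i,j)$ be an addable cell of $\mathrm{dom}(w)$. 1. The map $\mathcal P\mapsto\mathcal P\cup\{(i,j)\}$ defines a bijection from $\overline{\mathsf{Pipes}}(w)$ to the disjoint union $\bigsqcup_{u\in\overline{\Phi}_i(w)}\overline{\mathsf{Pipes}}(u)$. 2. The map $\mathcal P\mapsto\mathcal P\cup\{(i,j)\}$ defines a bijection from $\mathsf{Pipes}(w)$ to the disjoint union $\bigsqcup_{u\in\Phi_i(w)}\mathsf{Pipes}(u)$. -/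

import Mathlib

/-! Rows, columns, pipes and the letters permuted by a permutation are indexed from `0`: the cell
`(i, j) : ℕ × ℕ` is the cell in row `i + 1` (from the top) and column `j + 1` (from the left) of the
usual matrix coordinates, and `k : ℕ` stands for the positive integer `k + 1`. -/

namespace PipeDream

/-- Membership in `S_+`: all but finitely many points are fixed. -/
def IsFinitary (w : Equiv.Perm ℕ) : Prop := {k | w k ≠ k}.Finite

/-- `w ∈ S_n`, where `S_n` is embedded in `S_+` as the permutations that fix everything beyond the
first `n` letters. -/
def MemS (n : ℕ) (w : Equiv.Perm ℕ) : Prop := ∀ k, n ≤ k → w k = k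

/-- The Rothe diagram: the cells that are neither weakly to the right of a dot `(a, w a)` in its row
nor weakly below a dot in its column. -/
def rotheDiagram (w : Equiv.Perm ℕ) : Set (ℕ × ℕ) :=
  {c | (∀ a, a = c.1 → c.2 < w a) ∧ (∀ a, w a = c.2 → c.1 < a)}

/-- `μ` is the dominant part of `U`: the largest Young diagram contained in `U`. -/
def IsDominantPart (U : Set (ℕ × ℕ)) (μ : YoungDiagram) : Prop :=
  IsGreatest {ν : YoungDiagram | (ν.cells : Set (ℕ × ℕ)) ⊆ U} μ

/-- `(i, j)` is an addable cell of the Young diagram `μ`. -/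
def IsAddable (μ : YoungDiagram) (i j : ℕ) : Prop :=
  (i, j) ∉ μ ∧ (0 < i → (i - 1, j) ∈ μ) ∧ (0 < j → (i, j - 1) ∈ μ)

/-- `P` is the set of crossings of a pipe dream of size `n`, i.e. a subset of the staircase
`𝕋_n` of the cells strictly above the antidiagonal of the `n × n` grid. The other cells strictly above
the antidiagonal carry a bump, and each cell of the antidiagonal carries a single elbow. -/
def IsPipeDream (n : ℕ) (P : Finset (ℕ × ℕ)) : Prop := ∀ c ∈ P, c.1 + c.2 + 2 ≤ n

mutual

/-- Propagation of labels along the pipes of a pipe dream of size `n`, starting with the labels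
`0, 1, 2, …` on the top edge of the grid and travelling south and west. `west cross n P i j` is the
label on the left edge of the cell `(i, j)`, and `north cross n P i j` the one on its top edge.
At a bump (or at an elbow of the antidiagonal) the label on the top edge passes to the left edge, and
the label on the right edge passes to the bottom edge. At a crossing with label `t` on its top edge and
label `e` on its right edge, `cross t e` is the pair of the labels on its left and bottom edges. -/
def west (cross : ℕ → ℕ → ℕ × ℕ) (n : ℕ) (P : Finset (ℕ × ℕ)) (i j : ℕ) : ℕ :=
  if i + j + 1 < n then
    if (i, j) ∈ P then (cross (north cross n P i j) (west cross n P i (j + 1))).1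
    else north cross n P i j
  else north cross n P i j
termination_by (i, n - j + 1)

/-- The label on the top edge of the cell `(i, j)`; see `west`. -/
def north (cross : ℕ → ℕ → ℕ × ℕ) (n : ℕ) (P : Finset (ℕ × ℕ)) (i j : ℕ) : ℕ :=
  match i with
  | 0 => j
  | i + 1 =>
    if (i, j) ∈ P then (cross (north cross n P i j) (west cross n P i (j + 1))).2
    else west cross n P i (j + 1)
termination_by (i, 0)

end

/-- Following the pipes themselves: both pipes go straight through a crossing. -/
def straight (t e : ℕ) : ℕ × ℕ := (e, t)

/-- The label rule that defines the permutation of a pipe dream: the larger of the two labels leaves a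
crossing on the left and the smaller one at the bottom, so that a crossing of two pipes that have
crossed before is ignored. -/
def sorted (t e : ℕ) : ℕ × ℕ := (max t e, min t e)

/-- `δ(P) = w` for a pipe dream `P` of size `n`: the labels on the left edge of the grid, read from
top to bottom, are the one-line notation of `w`. -/
def HasPermutation (n : ℕ) (P : Finset (ℕ × ℕ)) (w : Equiv.Perm ℕ) : Prop :=
  ∀ i, i < n → west sorted n P i 0 = w i

/-- The two pipes that cross at the crossing `c`, each named by the column in which it starts. -/
def crossingPipes (n : ℕ) (P : Finset (ℕ × ℕ)) (c : ℕ × ℕ) : Sym2 ℕ :=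
  s(north straight n P c.1 c.2, west straight n P c.1 (c.2 + 1))

/-- Each pair of pipes crosses at most one time. -/
def IsReduced (n : ℕ) (P : Finset (ℕ × ℕ)) : Prop :=
  ∀ c ∈ P, ∀ d ∈ P, crossingPipes n P c = crossingPipes n P d → c = d

/-- The set of all pipe dreams of `w ∈ S_+`, where `w` is viewed as an element of some `S_n`. -/
def allPipes (w : Equiv.Perm ℕ) : Set (Finset (ℕ × ℕ)) :=
  {P | ∃ n, MemS n w ∧ IsPipeDream n P ∧ HasPermutation n P w}

/-- The set of reduced pipe dreams of `w ∈ S_+`. -/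
def reducedPipes (w : Equiv.Perm ℕ) : Set (Finset (ℕ × ℕ)) :=
  {P | ∃ n, MemS n w ∧ IsPipeDream n P ∧ HasPermutation n P w ∧ IsReduced n P}

/-- `(a, b)` is a neighbor of `(i, j)` in `w`. -/
def IsNeighbor (w : Equiv.Perm ℕ) (i j a b : ℕ) : Prop :=
  b = w a ∧ (i ≤ a ∧ j ≤ b) ∧ (i, j) ≠ (a, b) ∧
    ∀ a' b', a' ∈ Set.Icc i a → b' ∈ Set.Icc j b → (a', b') ≠ (i, j) → (a', b') ≠ (a, b) → b' ≠ w a'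

/-- `φ_i(w)`, the set of the rows of the neighbors of `(i, w i)`. -/
def phi (i : ℕ) (w : Equiv.Perm ℕ) : Set ℕ := {k | IsNeighbor w i (w i) k (w k)}

/-- `Φ_i(w)`, the set of all `w t_{i,k}` with `k ∈ φ_i(w)`. -/
def Phi (i : ℕ) (w : Equiv.Perm ℕ) : Set (Equiv.Perm ℕ) :=
  {u | ∃ k ∈ phi i w, u = w * Equiv.swap i k}

/-- `w t_{i,i_k} t_{i,i_{k-1}} ⋯ t_{i,i_1}`, where `U = {i_1 < i_2 < ⋯ < i_k}`. -/
def mulSwaps (w : Equiv.Perm ℕ) (U : Finset ℕ) (i : ℕ) : Equiv.Perm ℕ :=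
  w * ((U.sort (fun a b => b ≤ a)).map (fun k => Equiv.swap i k)).prod

/-- `Φ̄_i(w)`, the set of all `w t_{i,i_k} ⋯ t_{i,i_1}` with
`∅ ≠ {i_1 < ⋯ < i_k} ⊆ φ_i(w)`. -/
def PhiBar (i : ℕ) (w : Equiv.Perm ℕ) : Set (Equiv.Perm ℕ) :=
  {u | ∃ U : Finset ℕ, U.Nonempty ∧ (U : Set ℕ) ⊆ phi i w ∧ u = mulSwaps w U i}

end PipeDream

namespace PipeDream

open Equiv

-- Read the crossings of `P` row by row from the top, each row from right to left, and let a
-- crossing in `(r, c)` sort the letters in positions `r + c` and `r + c + 1` decreasingly. The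
-- result, a Demazure product, is the permutation of `P` (`hasPermutation_iff`), and `P` is reduced
-- exactly when every crossing meets an ascent (`isReduced_iff`).
--
-- An addable cell `(i, j)` of the dominant part satisfies `w i = j`, and every pipe dream of `w`
-- has crossings in all cells weakly northwest of `(i, j)` except `(i, j)` itself. Just before that
-- cell is read, positions `i, …, i + j` hold `0, …, j`, so a new crossing there multiplies by one
-- adjacent transposition. The crossings to its left in row `i` turn it into `swap i (i + j + 1)`, a
-- swap of dot `i` with a neighbor. The later rows act only in positions beyond `i`, and such an
-- action carries a decreasing chain of neighbor swaps at `i` to another one, possibly of different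
-- length (`SwapChain.act_act`). The ends of chains from `w` of nonzero length are precisely the
-- elements of `PhiBar i w`.
--
-- Surjectivity: erasing `(i, j)` from a pipe dream of `u` in `PhiBar i w` gives some `w'` with `w'
-- i = j` and a chain from `w'` to `u`; a chain is determined by its end and the initial letter at
-- `i` (`SwapChain.unique`), so `w' = w`. For the reduced statement, the chain length equals the
-- gain in ascents, while the word grows by one letter; hence reducedness corresponds to length `1`.

theorem mem_phi_iff {i k : ℕ} {w : Perm ℕ} :
    k ∈ phi i w ↔ i < k ∧ w i < w k ∧ ∀ a, i < a → a < k → w a < w i ∨ w k < w a := by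
  simp only [phi, IsNeighbor, Set.mem_ofPred_eq, Set.mem_Icc, ne_eq, Prod.mk.injEq, true_and]
  constructor
  · rintro ⟨⟨h1, h2⟩, h3, h4⟩
    have hik : i ≠ k := fun h => h3 ⟨h, by rw [h]⟩
    have hw : w i ≠ w k := fun h => hik (w.injective h)
    refine ⟨by omega, by omega, fun a ha hk => ?_⟩
    by_contra! hc
    exact h4 a (w a) ⟨by omega, by omega⟩ ⟨by omega, by omega⟩ (by omega) (by omega) rfl
  · rintro ⟨h1, h2, h3⟩
    refine ⟨⟨by omega, by omega⟩, by omega, ?_⟩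
    rintro a b ⟨ha, ha'⟩ ⟨hb, hb'⟩ hne hne' rfl
    have h5 : a ≠ i := fun h => hne ⟨h, by rw [h]⟩
    have h6 : a ≠ k := fun h => hne' ⟨h, by rw [h]⟩
    have := h3 a (by omega) (by omega)
    omega

-- The `0`-Hecke action on one-line notations.

/-- The action of a generator of the `0`-Hecke monoid on one-line notations: the letters in the
positions `p` and `p + 1` are sorted decreasingly. -/
def act (v : Perm ℕ) (p : ℕ) : Perm ℕ := if v p < v (p + 1) then v * swap p (p + 1) else v

/-- `1` if `p` is an ascent of `v`, and `0` otherwise. -/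
def asc (v : Perm ℕ) (p : ℕ) : ℕ := if v p < v (p + 1) then 1 else 0

theorem act_of_lt {v : Perm ℕ} {p : ℕ} (h : v p < v (p + 1)) : act v p = v * swap p (p + 1) :=
  if_pos h

theorem act_of_gt {v : Perm ℕ} {p : ℕ} (h : v (p + 1) < v p) : act v p = v := if_neg h.not_gt

theorem asc_of_lt {v : Perm ℕ} {p : ℕ} (h : v p < v (p + 1)) : asc v p = 1 := if_pos h

theorem asc_of_gt {v : Perm ℕ} {p : ℕ} (h : v (p + 1) < v p) : asc v p = 0 := if_neg h.not_gt

theorem mul_swap_apply (v : Perm ℕ) (a b k : ℕ) :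
    (v * swap a b) k = if k = a then v b else if k = b then v a else v k := by
  rw [Perm.mul_apply, swap_apply_def]
  split_ifs <;> rfl

theorem act_apply_of_ne {v : Perm ℕ} {p k : ℕ} (h : k ≠ p) (h' : k ≠ p + 1) :
    act v p k = v k := by
  unfold act
  split_ifs
  · rw [mul_swap_apply, if_neg h, if_neg h']
  · rfl

-- Decreasing chains of neighbor swaps.

/-- `u` arises from `v` by successive multiplications with `swap i a`, for `n` decreasing numbers `a`
below `B`, each of which is the row of a neighbor of the dot in row `i`. -/
inductive SwapChain (i : ℕ) : ℕ → ℕ → Perm ℕ → Perm ℕ → Prop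
  | nil (B : ℕ) (v : Perm ℕ) : SwapChain i B 0 v v
  | cons {B a n : ℕ} {v u : Perm ℕ} (ha : a < B) (hv : a ∈ phi i v)
      (h : SwapChain i a n (v * swap i a) u) : SwapChain i B (n + 1) v u

namespace SwapChain

variable {i B n : ℕ} {v u : Perm ℕ}

theorem mono {B' : ℕ} (h : SwapChain i B n v u) (hB : B ≤ B') : SwapChain i B' n v u := by
  cases h with
  | nil => exact nil _ _
  | cons ha hv h => exact cons (ha.trans_le hB) hv h

theorem apply_of_lt (h : SwapChain i B n v u) : ∀ k, k < i → u k = v k := by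
  induction h with
  | nil => intros; rfl
  | cons ha hv h ih =>
    intro k hk
    have := (mem_phi_iff.1 hv).1
    rw [ih k hk, mul_swap_apply, if_neg (by omega), if_neg (by omega)]

theorem apply_of_ge (h : SwapChain i B n v u) : ∀ k, i < k → B ≤ k → u k = v k := by
  induction h with
  | nil => intros; rfl
  | cons ha hv h ih =>
    intro k hk hB
    rw [ih k hk (by omega), mul_swap_apply, if_neg (by omega), if_neg (by omega)]

theorem apply_le (h : SwapChain i B n v u) : v i ≤ u i := by
  induction h with
  | nil => rfl
  | cons ha hv h ih =>
    rw [mul_swap_apply, if_pos rfl] at ih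
    exact (mem_phi_iff.1 hv).2.1.le.trans ih

theorem apply_lt (h : SwapChain i B n v u) (hn : n ≠ 0) : v i < u i := by
  cases h with
  | nil => exact absurd rfl hn
  | cons ha hv h =>
    have := h.apply_le
    rw [mul_swap_apply, if_pos rfl] at this
    exact (mem_phi_iff.1 hv).2.1.trans_le this

/-- All swaps take place among the rows in `[i, B)`, so the letters there are only permuted. -/
theorem exists_apply_eq (h : SwapChain i B n v u) :
    ∀ k, i ≤ k → k < B → ∃ l, i ≤ l ∧ l < B ∧ v l = u k := by
  induction h with
  | nil => exact fun k h1 h2 => ⟨k, h1, h2, rfl⟩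
  | @cons B a n v u ha hv h ih =>
    intro k h1 h2
    have hi := (mem_phi_iff.1 hv).1
    rcases lt_or_ge k a with hk | hk
    · obtain ⟨l, h3, h4, h5⟩ := ih k h1 hk
      rw [mul_swap_apply, if_neg h4.ne] at h5
      split_ifs at h5
      · exact ⟨a, hi.le, ha, h5⟩
      · exact ⟨l, h3, by omega, h5⟩
    · rw [h.apply_of_ge k (by omega) hk, mul_swap_apply, if_neg (by omega)]
      split_ifs
      · exact ⟨i, le_rfl, by omega, rfl⟩
      · exact ⟨k, h1, h2, rfl⟩

theorem exists_apply_eq' (h : SwapChain i B n v u) :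
    ∀ k, i ≤ k → k < B → ∃ l, i ≤ l ∧ l < B ∧ u l = v k := by
  intro k h1 h2
  refine ⟨u.symm (v k), ?_, ?_, by simp⟩
  · by_contra! hc
    have := h.apply_of_lt _ hc
    rw [apply_symm_apply] at this
    have := v.injective this
    omega
  · by_contra! hc
    rcases eq_or_ne (u.symm (v k)) i with h3 | h3
    · omega
    by_cases h4 : u.symm (v k) < i
    · have := h.apply_of_lt _ h4
      rw [apply_symm_apply] at this
      have := v.injective this
      omega
    have := h.apply_of_ge _ (by omega) hc
    rw [apply_symm_apply] at this
    have := v.injective this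
    omega

/-- The bound may be lowered past a row whose dot is to the left of the dot in row `i`. -/
theorem lower {p : ℕ} (h : SwapChain i (p + 1) n v u) (hp : v p < v i) : SwapChain i p n v u := by
  cases h with
  | nil => exact nil _ _
  | @cons _ a _ _ _ ha hv h =>
    have h1 : a ≠ p := by
      rintro rfl
      exact hp.not_gt (mem_phi_iff.1 hv).2.1
    exact cons (by omega) hv h

/-- A chain is determined by its end and by the letter in position `i` at its start. -/
theorem unique (h : SwapChain i B n v u) :
    ∀ {B' n' : ℕ} {v' : Perm ℕ}, SwapChain i B' n' v' u → v' i = v i → v' = v ∧ n' = n := by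
  induction h with
  | nil B v =>
    intro B' n' v' h' hi
    by_cases hn : n' = 0
    · subst hn
      cases h'
      exact ⟨rfl, rfl⟩
    · exact absurd hi (h'.apply_lt hn).ne
  | @cons B a n v u ha hv h ih =>
    intro B' n' v' h' hi
    cases h' with
    | nil =>
      have := (cons ha hv h).apply_lt (Nat.succ_ne_zero n)
      omega
    | @cons _ a' n' _ _ ha' hv' h' =>
      rw [mem_phi_iff] at hv hv'
      -- Later swaps involve only `i` and rows below `a`, so `v i` stays in row `a`; hence `u` and
      -- `v i` determine the first swap.
      have h1 : u a = v i := by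
        rw [h.apply_of_ge a hv.1 le_rfl, mul_swap_apply, if_neg (by omega), if_pos rfl]
      have h2 : u a' = v' i := by
        rw [h'.apply_of_ge a' hv'.1 le_rfl, mul_swap_apply, if_neg (by omega), if_pos rfl]
      obtain rfl : a' = a := u.injective (by omega)
      -- If the two letters differed, each would sit in the other permutation strictly between rows
      -- `i` and `a`; the emptiness of the two neighbor boxes would make each smaller than the
      -- other.
      have key : v' a' = v a' := by
        obtain ⟨k, h3, h4, h5⟩ := h.exists_apply_eq' i le_rfl hv.1
        obtain ⟨l, h6, h7, h8⟩ := h'.exists_apply_eq k h3 h4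
        obtain ⟨k', h3', h4', h5'⟩ := h'.exists_apply_eq' i le_rfl hv.1
        obtain ⟨l', h6', h7', h8'⟩ := h.exists_apply_eq k' h3' h4'
        simp only [mul_swap_apply, if_true, h7.ne, h7'.ne, if_false] at h5 h8 h5' h8'
        split_ifs at h8 h8'
        · omega
        · omega
        · omega
        · have := hv'.2.2 l (by omega) h7
          have := hv.2.2 l' (by omega) h7'
          omega
      obtain ⟨h9, rfl⟩ := ih h' (by simp [key])
      exact ⟨mul_right_cancel h9, rfl⟩

/-- Chains are preserved by the `0`-Hecke action in the positions beyond `i`. -/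
theorem act_act {p : ℕ} (hp : i < p) (h : SwapChain i B n v u)
    (hB : B = p + 1 → v (p + 1) < v i) :
    ∃ n', SwapChain i B n' (act v p) (act u p) ∧ n' + asc v p = n + asc u p := by
  -- `hB` protects the bound: a swap with row `p` may become one with row `p + 1`. The cases are `a
  -- = p`, `a = p + 1`, and `a` away from both, where the transpositions commute.
  induction h with
  | nil B v => exact ⟨0, nil _ _, rfl⟩
  | @cons B a n v u ha hv h ih =>
    have hv' := mem_phi_iff.1 hv
    obtain ⟨hia, hlt, hbox⟩ := hv'
    obtain ⟨n', h', hn'⟩ := ih (by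
      rintro rfl
      rw [mul_swap_apply, mul_swap_apply, if_neg (by omega), if_pos rfl, if_pos rfl]
      exact hlt)
    have hne : v p ≠ v (p + 1) := fun h => by simpa using v.injective h
    have hvi : ∀ k, i < k → v k ≠ v i := fun k hk h => hk.ne' (v.injective h)
    have hsw : ∀ x y : ℕ, x ≠ p → x ≠ p + 1 → y ≠ p → y ≠ p + 1 →
        v * swap p (p + 1) * swap x y = v * swap x y * swap p (p + 1) := fun x y h1 h2 h3 h4 => by
      ext k
      simp only [mul_swap_apply]
      grind
    by_cases hap : a = p
    · subst hap
      have e1 : (v * swap i a) a = v i := by simp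
      have e2 : (v * swap i a) (a + 1) = v (a + 1) := by
        rw [mul_swap_apply, if_neg (by omega), if_neg (by omega)]
      have hia1 := hvi (a + 1) (by omega)
      rcases lt_or_gt_of_ne hne with hlt' | hgt
      · have h3 : (v * swap i a) a < (v * swap i a) (a + 1) := by omega
        rw [asc_of_lt h3] at hn'
        rw [act_of_lt h3] at h'
        refine ⟨n' + 1, ?_, by rw [asc_of_lt hlt']; omega⟩
        rw [act_of_lt hlt']
        refine cons (a := a + 1) ?_ ?_ ?_
        · by_contra! hc
          have := hB (by omega)
          omega
        · rw [mem_phi_iff]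
          simp only [mul_swap_apply]
          refine ⟨by omega, by grind, fun b hb hb' => ?_⟩
          by_cases hba : b = a
          · grind
          · have := hbox b hb (by omega)
            grind
        · convert h'.mono (Nat.le_succ a) using 1
          ext k
          simp only [mul_swap_apply]
          grind
      · rw [asc_of_gt hgt, act_of_gt hgt]
        rcases lt_or_gt_of_ne hia1 with h4 | h4
        · have h3 : (v * swap i a) (a + 1) < (v * swap i a) a := by omega
          rw [asc_of_gt h3] at hn'
          rw [act_of_gt h3] at h'
          exact ⟨n' + 1, cons ha hv h', by omega⟩
        · have h3 : (v * swap i a) a < (v * swap i a) (a + 1) := by omega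
          rw [asc_of_lt h3] at hn'
          rw [act_of_lt h3] at h'
          -- Here the chain grows: `p` is a descent of `v` but an ascent after the swap, and `swap i
          -- p * swap p (p + 1) = swap i (p + 1) * swap i p`.
          refine ⟨n' + 1 + 1, cons (a := a + 1) ?_ ?_ (cons (a := a) (by omega) ?_ ?_), by omega⟩
          · by_contra! hc
            have := hB (by omega)
            omega
          · rw [mem_phi_iff]
            refine ⟨by omega, by omega, fun b hb hb' => ?_⟩
            by_cases hba : b = a
            · grind
            · have := hbox b hb (by omega)
              grind
          · rw [mem_phi_iff]
            simp only [mul_swap_apply]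
            refine ⟨by omega, by grind, fun b hb hb' => ?_⟩
            have := hbox b hb (by omega)
            grind
          · convert h' using 1
            ext k
            simp only [mul_swap_apply]
            grind
    by_cases hap1 : a = p + 1
    · subst hap1
      have e1 : (v * swap i (p + 1)) (p + 1) = v i := by simp
      have e2 : (v * swap i (p + 1)) p = v p := by
        rw [mul_swap_apply, if_neg (by omega), if_neg (by omega)]
      rcases hbox p hp (by omega) with h4 | h4
      · have h3 : (v * swap i (p + 1)) p < (v * swap i (p + 1)) (p + 1) := by omega
        have h5 : v p < v (p + 1) := by omega
        rw [asc_of_lt h3] at hn'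
        rw [act_of_lt h3] at h'
        rw [asc_of_lt h5, act_of_lt h5]
        refine ⟨n' + 1, cons (a := p) (by omega) ?_ ?_, by omega⟩
        · rw [mem_phi_iff]
          simp only [mul_swap_apply]
          refine ⟨by omega, by grind, fun b hb hb' => ?_⟩
          have := hbox b hb (by omega)
          grind
        -- The first swap moves from row `p + 1` to row `p`, so the rest of the chain must stay
        -- below `p`.
        · have h6 := h'.lower (by simp only [mul_swap_apply]; grind)
          convert h6 using 1
          ext k
          simp only [mul_swap_apply]
          grind
      · have h3 : (v * swap i (p + 1)) (p + 1) < (v * swap i (p + 1)) p := by omega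
        rw [asc_of_gt h3] at hn'
        rw [act_of_gt h3] at h'
        rw [asc_of_gt h4, act_of_gt h4]
        exact ⟨n' + 1, cons ha hv h', by omega⟩
    have e1 : (v * swap i a) p = v p := by
      rw [mul_swap_apply, if_neg (by omega), if_neg (by omega)]
    have e2 : (v * swap i a) (p + 1) = v (p + 1) := by
      rw [mul_swap_apply, if_neg (by omega), if_neg (by omega)]
    rcases lt_or_gt_of_ne hne with h4 | h4
    · have h3 : (v * swap i a) p < (v * swap i a) (p + 1) := by omega
      rw [asc_of_lt h3] at hn'
      rw [act_of_lt h3] at h'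
      rw [asc_of_lt h4, act_of_lt h4]
      refine ⟨n' + 1, cons ha ?_ ?_, by omega⟩
      · rw [mem_phi_iff]
        simp only [mul_swap_apply]
        refine ⟨by omega, by grind, fun b hb hb' => ?_⟩
        have := hbox b hb (by omega)
        have := hbox (b + 1) (by omega)
        have := hbox (b - 1)
        grind
      · rwa [hsw i a (by omega) (by omega) hap hap1]
    · have h3 : (v * swap i a) (p + 1) < (v * swap i a) p := by omega
      rw [asc_of_gt h3] at hn'
      rw [act_of_gt h3] at h'
      rw [asc_of_gt h4, act_of_gt h4]
      exact ⟨n' + 1, cons ha hv h', by omega⟩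

end SwapChain

-- Chains as subsets of `phi`.

theorem mulSwaps_insert (w : Perm ℕ) {U : Finset ℕ} {a : ℕ} (i : ℕ) (ha : ∀ b ∈ U, b < a) :
    mulSwaps w (insert a U) i = mulSwaps (w * swap i a) U i := by
  have h : a ∉ U := fun h => (ha a h).false
  unfold mulSwaps
  rw [Finset.sort_insert (fun a b => b ≤ a) (fun b hb => (ha b hb).le) h]
  simp [mul_assoc]

theorem mulSwaps_empty (w : Perm ℕ) (i : ℕ) : mulSwaps w ∅ i = w := by
  simp [mulSwaps]

/-- Rows strictly between `i` and a neighbor `a` hold letters below `v i` or above `v a`, so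
replacing `v i` by `v a` leaves the neighbors in rows before `a` unchanged. The converse
`swapChain_mulSwaps` uses the same fact. -/
theorem SwapChain.exists_finset {i B n : ℕ} {v u : Perm ℕ} (h : SwapChain i B n v u) :
    ∃ U : Finset ℕ, U.card = n ∧ (U : Set ℕ) ⊆ phi i v ∧ (∀ a ∈ U, a < B) ∧
      u = mulSwaps v U i := by
  induction h with
  | nil B v => exact ⟨∅, by simp [mulSwaps_empty]⟩
  | @cons B a n v u ha hv h ih =>
    obtain ⟨U, hU, hphi, hlt, rfl⟩ := ih
    have h1 : a ∉ U := fun h => (hlt a h).false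
    refine ⟨insert a U, by rw [Finset.card_insert_of_notMem h1, hU], ?_, ?_,
      (mulSwaps_insert v i hlt).symm⟩
    · rw [Finset.coe_insert, Set.insert_subset_iff]
      refine ⟨hv, fun b hb => ?_⟩
      have h2 := hphi hb
      have h3 := hlt b hb
      rw [mem_phi_iff] at h2 hv ⊢
      simp only [mul_swap_apply] at h2
      refine ⟨h2.1, by grind, fun c hc hc' => ?_⟩
      have := h2.2.2 c hc hc'
      have := hv.2.2 c hc (by omega)
      grind
    · intro b hb
      rcases Finset.mem_insert.1 hb with rfl | hb
      · exact ha
      · exact (hlt b hb).trans ha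

theorem swapChain_mulSwaps {i : ℕ} (U : Finset ℕ) : ∀ {B : ℕ} {v : Perm ℕ},
    (U : Set ℕ) ⊆ phi i v → (∀ a ∈ U, a < B) → SwapChain i B U.card v (mulSwaps v U i) := by
  induction U using Finset.induction_on_max with
  | empty =>
    intro B v _ _
    rw [mulSwaps_empty]
    exact .nil _ _
  | insert a U ha ih =>
    intro B v hU hB
    rw [mulSwaps_insert v i ha, Finset.card_insert_of_notMem fun h => (ha a h).false]
    rw [Finset.coe_insert, Set.insert_subset_iff] at hU
    refine .cons (hB a (Finset.mem_insert_self a U)) hU.1 (ih (fun b hb => ?_) ha)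
    have h2 := hU.2 hb
    have h3 := ha b hb
    have hv := hU.1
    rw [mem_phi_iff] at h2 hv ⊢
    simp only [mul_swap_apply]
    have := hv.2.2 b h2.1 h3
    refine ⟨h2.1, by grind, fun c hc hc' => ?_⟩
    have := h2.2.2 c hc hc'
    have := hv.2.2 c hc (by omega)
    grind

-- Labels of a pipe dream and their independence of its size.

section Labels

variable {cross : ℕ → ℕ → ℕ × ℕ} {n m : ℕ} {P : Finset (ℕ × ℕ)}

theorem north_zero (c : ℕ) : north cross n P 0 c = c := by rw [north]

theorem north_succ (r c : ℕ) : north cross n P (r + 1) c =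
    if (r, c) ∈ P then (cross (north cross n P r c) (west cross n P r (c + 1))).2
    else west cross n P r (c + 1) := by
  rw [north]

theorem west_eq (hP : IsPipeDream n P) (r c : ℕ) : west cross n P r c =
    if (r, c) ∈ P then (cross (north cross n P r c) (west cross n P r (c + 1))).1
    else north cross n P r c := by
  rw [west]
  split_ifs with h1 h2 h2
  · rfl
  · rfl
  · exact absurd (hP _ h2) (by simp only; omega)
  · rfl

/-- The recursion runs leftwards along the row, starting beyond column `n`, where there are no
crossings. -/
theorem west_eq_west_of_north (hP : IsPipeDream n P) (hP' : IsPipeDream m P) (r : ℕ)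
    (h : ∀ c, north cross n P r c = north cross m P r c) (d : ℕ) :
    ∀ c, n ≤ c + d → west cross n P r c = west cross m P r c := by
  induction d with
  | zero =>
    intro c hc
    have : (r, c) ∉ P := fun h => absurd (hP _ h) (by simp only; omega)
    rw [west_eq hP, west_eq hP', if_neg this, if_neg this, h]
  | succ d ih =>
    intro c hc
    rw [west_eq hP, west_eq hP', h, ih (c + 1) (by omega)]

/-- The labels do not depend on the size. -/
theorem north_eq_north (hP : IsPipeDream n P) (hP' : IsPipeDream m P) (r : ℕ) :
    ∀ c, north cross n P r c = north cross m P r c := by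
  induction r with
  | zero => simp [north_zero]
  | succ r ih =>
    intro c
    rw [north_succ, north_succ, ih,
      west_eq_west_of_north hP hP' r ih n (c + 1) (by omega)]

theorem west_eq_west (hP : IsPipeDream n P) (hP' : IsPipeDream m P) (r c : ℕ) :
    west cross n P r c = west cross m P r c :=
  west_eq_west_of_north hP hP' r (north_eq_north hP hP' r) n c (by omega)

theorem crossingPipes_eq (hP : IsPipeDream n P) (hP' : IsPipeDream m P) (c : ℕ × ℕ) :
    crossingPipes n P c = crossingPipes m P c := by
  rw [crossingPipes, crossingPipes, north_eq_north hP hP', west_eq_west hP hP']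

theorem isReduced_congr (hP : IsPipeDream n P) (hP' : IsPipeDream m P) :
    IsReduced n P ↔ IsReduced m P := by
  simp only [IsReduced, crossingPipes_eq hP hP']

end Labels

-- Reading words and fronts.

/-- The first `c` cells of row `r`, from right to left. -/
def rowCells (r : ℕ) : ℕ → List (ℕ × ℕ)
  | 0 => []
  | c + 1 => (r, c) :: rowCells r c

/-- The cells of the first `k` rows and the first `m` columns, row by row from top to bottom, and
from right to left in each row. -/
def readCells (m : ℕ) : ℕ → List (ℕ × ℕ)
  | 0 => []
  | k + 1 => readCells m k ++ rowCells k m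

/-- The positions of the generators that correspond to the crossings of `P` in a list of cells. -/
def wordOf (P : Finset (ℕ × ℕ)) (L : List (ℕ × ℕ)) : List ℕ :=
  (L.filter (· ∈ P)).map fun c => c.1 + c.2

theorem mem_rowCells {r c : ℕ} {x : ℕ × ℕ} : x ∈ rowCells r c ↔ x.1 = r ∧ x.2 < c := by
  induction c with
  | zero => simp [rowCells]
  | succ c ih =>
    rw [rowCells, List.mem_cons, ih, Prod.ext_iff]
    simp only
    omega

theorem mem_readCells {m k : ℕ} {x : ℕ × ℕ} : x ∈ readCells m k ↔ x.1 < k ∧ x.2 < m := by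
  induction k with
  | zero => simp [readCells]
  | succ k ih =>
    rw [readCells, List.mem_append, ih, mem_rowCells]
    omega

theorem nodup_rowCells (r c : ℕ) : (rowCells r c).Nodup := by
  induction c with
  | zero => simp [rowCells]
  | succ c ih =>
    rw [rowCells, List.nodup_cons, mem_rowCells]
    exact ⟨by simp, ih⟩

theorem nodup_readCells (m k : ℕ) : (readCells m k).Nodup := by
  induction k with
  | zero => simp [readCells]
  | succ k ih =>
    rw [readCells, List.nodup_append']
    refine ⟨ih, nodup_rowCells k m, fun x hx hx' => ?_⟩
    rw [mem_readCells] at hx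
    rw [mem_rowCells] at hx'
    omega

theorem wordOf_append (P : Finset (ℕ × ℕ)) (L L' : List (ℕ × ℕ)) :
    wordOf P (L ++ L') = wordOf P L ++ wordOf P L' := by
  simp [wordOf]

theorem wordOf_cons (P : Finset (ℕ × ℕ)) (x : ℕ × ℕ) (L : List (ℕ × ℕ)) :
    wordOf P (x :: L) = if x ∈ P then (x.1 + x.2) :: wordOf P L else wordOf P L := by
  simp only [wordOf, List.filter_cons, decide_eq_true_eq]
  split_ifs <;> rfl

/-- `op` modifies the letters in the positions `p` and `p + 1` by the rule `cross`. -/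
def Implements (op : Perm ℕ → ℕ → Perm ℕ) (cross : ℕ → ℕ → ℕ × ℕ) : Prop :=
  ∀ v p k, op v p k = if k = p then (cross (v p) (v (p + 1))).1
    else if k = p + 1 then (cross (v p) (v (p + 1))).2 else v k

theorem implements_act : Implements act sorted := by
  intro v p k
  unfold act sorted
  have hne : v p ≠ v (p + 1) := fun h => by simpa using v.injective h
  split_ifs with h h1 h2 h1 h2
  · subst h1
    simpa using h.le
  · subst h2
    simpa using h.le
  · rw [mul_swap_apply, if_neg h1, if_neg h2]
  · subst h1
    simp only
    omega
  · subst h2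
    simp only
    omega
  · rfl

/-- Multiplication by the adjacent transposition of `p` and `p + 1` on the right. -/
def mulAdj (v : Perm ℕ) (p : ℕ) : Perm ℕ := v * swap p (p + 1)

theorem implements_mulAdj : Implements mulAdj straight := by
  intro v p k
  exact mul_swap_apply v p (p + 1) k

section Front

variable {op : Perm ℕ → ℕ → Perm ℕ} {cross : ℕ → ℕ → ℕ × ℕ} {n : ℕ} {P : Finset (ℕ × ℕ)}

/-- The letters of `v` are the labels on the edges that separate the cells read before `(r, c - 1)`
from the others. -/
def IsFront (cross : ℕ → ℕ → ℕ × ℕ) (n : ℕ) (P : Finset (ℕ × ℕ)) (r c : ℕ) (v : Perm ℕ) : Prop :=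
  (∀ k < r, v k = west cross n P k 0) ∧ (∀ b < c, v (r + b) = north cross n P r b) ∧
    v (r + c) = west cross n P r c ∧ ∀ b, c ≤ b → v (r + 1 + b) = north cross n P (r + 1) b

theorem IsFront.step (hop : Implements op cross) (hP : IsPipeDream n P) {r c : ℕ} {v : Perm ℕ}
    (h : IsFront cross n P r (c + 1) v) :
    IsFront cross n P r c (if (r, c) ∈ P then op v (r + c) else v) := by
  obtain ⟨h1, h2, h3, h4⟩ := h
  have h2c := h2 c (by omega)
  split_ifs with hc
  · refine ⟨fun k hk => ?_, fun b hb => ?_, ?_, fun b hb => ?_⟩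
    · rw [hop, if_neg (by omega), if_neg (by omega), h1 k hk]
    · rw [hop, if_neg (by omega), if_neg (by omega), h2 b (by omega)]
    · rw [hop, if_pos rfl, west_eq hP, if_pos hc, h2c, ← h3, add_assoc]
    · rcases eq_or_lt_of_le hb with rfl | hb
      · rw [hop, if_neg (by omega), if_pos (by omega), north_succ, if_pos hc, h2c, ← h3, add_assoc]
      · rw [hop, if_neg (by omega), if_neg (by omega), h4 b hb]
  · refine ⟨h1, fun b hb => h2 b (by omega), ?_, fun b hb => ?_⟩
    · rw [west_eq hP, if_neg hc, h2c]
    · rcases eq_or_lt_of_le hb with rfl | hb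
      · rw [north_succ, if_neg hc, ← h3]
        congr 1
        omega
      · exact h4 b hb

theorem IsFront.row_append (hop : Implements op cross) (hP : IsPipeDream n P) {r : ℕ} (d c : ℕ) :
    ∀ {v : Perm ℕ}, IsFront cross n P r (c + d) v → ∃ L, rowCells r (c + d) = L ++ rowCells r c ∧
      (∀ x ∈ L, c ≤ x.2 ∧ x.1 = r) ∧ IsFront cross n P r c ((wordOf P L).foldl op v) := by
  induction d with
  | zero => exact fun h => ⟨[], rfl, by simp, h⟩
  | succ d ih =>
    intro v h
    obtain ⟨L, h1, h2, h3⟩ := ih (IsFront.step (c := c + d) hop hP h)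
    refine ⟨(r, c + d) :: L, ?_, ?_, ?_⟩
    · rw [← add_assoc, rowCells, h1, List.cons_append]
    · simpa using h2
    · rw [wordOf_cons]
      split_ifs at h3 ⊢ <;> exact h3

theorem IsFront.row (hop : Implements op cross) (hP : IsPipeDream n P) {r c : ℕ} {v : Perm ℕ}
    (h : IsFront cross n P r c v) :
    IsFront cross n P r 0 ((wordOf P (rowCells r c)).foldl op v) := by
  obtain ⟨L, h1, -, h2⟩ := IsFront.row_append hop hP c 0 (by rwa [zero_add])
  rw [zero_add, rowCells, List.append_nil] at h1
  rwa [h1]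

/-- Without crossings from column `n` on, a label on a top edge passes to the left edge and then to
the bottom edge of the previous column, which accounts for the shift by one. -/
theorem isFront_of_ge (hP : IsPipeDream n P) {r m : ℕ} (hm : n ≤ m) {v : Perm ℕ}
    (h1 : ∀ k < r, v k = west cross n P k 0) (h2 : ∀ b, v (r + b) = north cross n P r b) :
    IsFront cross n P r m v := by
  have h3 : ∀ c, m ≤ c → west cross n P r c = north cross n P r c := fun c hc => by
    rw [west_eq hP, if_neg fun h => absurd (hP _ h) (by simp only; omega)]
  refine ⟨h1, fun b _ => h2 b, by rw [h2, h3 _ le_rfl], fun b hb => ?_⟩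
  rw [north_succ, if_neg fun h => absurd (hP _ h) (by simp only; omega), h3 _ (by omega), ← h2]
  congr 1
  omega

theorem isFront_readCells (hop : Implements op cross) (hP : IsPipeDream n P) {m : ℕ} (hm : n ≤ m)
    (r : ℕ) : IsFront cross n P r m ((wordOf P (readCells m r)).foldl op 1) := by
  induction r with
  | zero => exact isFront_of_ge hP hm (by simp) fun b => by simp [readCells, wordOf, north_zero]
  | succ r ih =>
    obtain ⟨h1, -, h2, h3⟩ := ih.row hop hP
    rw [readCells, wordOf_append, List.foldl_append]
    refine isFront_of_ge hP hm (fun k hk => ?_) fun b => h3 b (Nat.zero_le b)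
    rcases Nat.lt_succ_iff_lt_or_eq.1 hk with hk | rfl
    · exact h1 k hk
    · simpa using h2

end Front

-- The Demazure product of a pipe dream.

/-- The Demazure product of the crossings of `P` in the first `m` rows and columns. -/
def demazure (m : ℕ) (P : Finset (ℕ × ℕ)) : Perm ℕ := (wordOf P (readCells m m)).foldl act 1

theorem demazure_apply {n m : ℕ} {P : Finset (ℕ × ℕ)} (hP : IsPipeDream n P) (hm : n ≤ m) {k : ℕ}
    (hk : k < m) : demazure m P k = west sorted n P k 0 :=
  (isFront_readCells implements_act hP hm m).1 k hk

theorem foldl_act_apply_of_forall_ne {k : ℕ} (W : List ℕ) (h : ∀ p ∈ W, k ≠ p ∧ k ≠ p + 1) :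
    ∀ v : Perm ℕ, W.foldl act v k = v k := by
  induction W with
  | nil => intro v; rfl
  | cons p W ih =>
    intro v
    rw [List.forall_mem_cons] at h
    rw [List.foldl_cons, ih h.2, act_apply_of_ne h.1.1 h.1.2]

theorem demazure_memS {n m : ℕ} {P : Finset (ℕ × ℕ)} (hP : IsPipeDream n P) :
    MemS n (demazure m P) := by
  intro k hk
  refine foldl_act_apply_of_forall_ne _ (fun p hp => ?_) 1
  simp only [wordOf, List.mem_map, List.mem_filter, decide_eq_true_eq] at hp
  obtain ⟨c, ⟨-, hc⟩, rfl⟩ := hp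
  have := hP c hc
  omega

theorem hasPermutation_iff {n m : ℕ} {P : Finset (ℕ × ℕ)} (hP : IsPipeDream n P) (hm : n ≤ m)
    {w : Perm ℕ} (hw : MemS n w) : HasPermutation n P w ↔ demazure m P = w := by
  constructor
  · intro h
    ext k
    rcases lt_or_ge k n with hk | hk
    · rw [demazure_apply hP hm (hk.trans_le hm), h k hk]
    · rw [demazure_memS hP k hk, hw k hk]
  · rintro rfl k hk
    exact (demazure_apply hP hm (hk.trans_le hm)).symm

-- Reducedness as a count of ascents.

/-- The pairs of letters exchanged by successive adjacent transpositions. -/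
def exchanges (v : Perm ℕ) : List ℕ → List (Sym2 ℕ)
  | [] => []
  | p :: W => s(v p, v (p + 1)) :: exchanges (mulAdj v p) W

/-- The number of generators in `W` that act nontrivially in the action of `W` on `v`. -/
def ascents (v : Perm ℕ) : List ℕ → ℕ
  | [] => 0
  | p :: W => asc v p + ascents (act v p) W

theorem exchanges_append (W W' : List ℕ) : ∀ v : Perm ℕ,
    exchanges v (W ++ W') = exchanges v W ++ exchanges (W.foldl mulAdj v) W' := by
  induction W with
  | nil => intro v; rfl
  | cons p W ih => intro v; simp [exchanges, ih]

theorem ascents_append (W W' : List ℕ) : ∀ v : Perm ℕ,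
    ascents v (W ++ W') = ascents v W + ascents (W.foldl act v) W' := by
  induction W with
  | nil => intro v; simp [ascents]
  | cons p W ih => intro v; simp [ascents, ih, add_assoc]

theorem asc_le_one (v : Perm ℕ) (p : ℕ) : asc v p ≤ 1 := by
  unfold asc
  split_ifs <;> omega

theorem ascents_le (W : List ℕ) : ∀ v : Perm ℕ, ascents v W ≤ W.length := by
  induction W with
  | nil => intro v; rfl
  | cons p W ih =>
    intro v
    have := ih (act v p)
    have := asc_le_one v p
    simp only [ascents, List.length_cons]
    omega

/-- The pairs of letters that form an inversion. -/
def inversions (v : Perm ℕ) : Set (Sym2 ℕ) := {x | ∃ k l, k < l ∧ v l < v k ∧ x = s(v k, v l)}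

theorem mk_mem_inversions {v : Perm ℕ} {k l : ℕ} (h : k < l) :
    s(v k, v l) ∈ inversions v ↔ v l < v k := by
  constructor
  · rintro ⟨k', l', h1, h2, h3⟩
    rw [Sym2.eq_iff] at h3
    rcases h3 with ⟨h4, h5⟩ | ⟨h4, h5⟩
    · omega
    · have := v.injective h4
      have := v.injective h5
      omega
  · exact fun h' => ⟨k, l, h, h', rfl⟩

theorem mem_inversions_mulAdj {v : Perm ℕ} {p : ℕ} (h : v p < v (p + 1)) (x : Sym2 ℕ) :
    x ∈ inversions (mulAdj v p) ↔ x = s(v p, v (p + 1)) ∨ x ∈ inversions v := by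
  constructor
  · rintro ⟨k, l, h1, h2, rfl⟩
    by_cases hk : k = p ∧ l = p + 1
    · left
      obtain ⟨rfl, rfl⟩ := hk
      simp [mulAdj, Sym2.eq_swap]
    · right
      refine ⟨swap p (p + 1) k, swap p (p + 1) l, ?_, h2, rfl⟩
      rw [swap_apply_def, swap_apply_def]
      split_ifs <;> omega
  · rintro (rfl | ⟨k, l, h1, h2, rfl⟩)
    · exact ⟨p, p + 1, by omega, by simpa [mulAdj] using h, by simp [mulAdj, Sym2.eq_swap]⟩
    · have hk : ¬ (k = p ∧ l = p + 1) := by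
        rintro ⟨rfl, rfl⟩
        omega
      refine ⟨swap p (p + 1) k, swap p (p + 1) l, ?_, ?_, ?_⟩
      · rw [swap_apply_def, swap_apply_def]
        split_ifs <;> omega
      · simpa [mulAdj] using h2
      · simp [mulAdj]

/-- All generators act nontrivially if and only if no pair of letters is exchanged two times. -/
theorem ascents_eq_length_iff (W : List ℕ) : ∀ v : Perm ℕ, ascents v W = W.length ↔
    (exchanges v W).Nodup ∧ ∀ x ∈ exchanges v W, x ∉ inversions v := by
  induction W with
  | nil => simp [ascents, exchanges]
  | cons p W ih =>
    intro v
    have hle := ascents_le W (act v p)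
    have hne : v p ≠ v (p + 1) := fun h => by simpa using v.injective h
    simp only [ascents, exchanges, List.length_cons, List.nodup_cons, List.forall_mem_cons,
      mk_mem_inversions (Nat.lt_succ_self p)]
    rcases lt_or_gt_of_ne hne with h | h
    · have h1 := ih (mulAdj v p)
      rw [asc_of_lt h, act_of_lt h, add_comm, Nat.add_right_cancel_iff]
      rw [mulAdj] at h1 ⊢
      rw [h1]
      -- At an ascent both actions agree and create exactly one inversion, the exchanged pair;
      -- forbidding it later is the `Nodup` condition. At a descent the pair is already an inversion
      -- and both sides fail.
      have h2 := mem_inversions_mulAdj h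
      rw [mulAdj] at h2
      simp only [h2, not_or]
      constructor
      · exact fun ⟨h3, h4⟩ => ⟨⟨fun h5 => (h4 _ h5).1 rfl, h3⟩, h.not_gt, fun x hx => (h4 x hx).2⟩
      · exact fun ⟨⟨h3, h4⟩, _, h5⟩ => ⟨h4, fun x hx => ⟨fun h6 => h3 (h6 ▸ hx), h5 x hx⟩⟩
    · rw [asc_of_gt h]
      constructor
      · omega
      · exact fun h' => absurd h h'.2.1

theorem exchanges_rowCells {n : ℕ} {P : Finset (ℕ × ℕ)} (hP : IsPipeDream n P) {r : ℕ} (c : ℕ) :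
    ∀ {v : Perm ℕ}, IsFront straight n P r c v → exchanges v (wordOf P (rowCells r c)) =
      ((rowCells r c).filter (· ∈ P)).map (crossingPipes n P) := by
  induction c with
  | zero => intro v _; rfl
  | succ c ih =>
    intro v h
    have h1 := ih (h.step implements_mulAdj hP)
    have h2 := h.2.1 c (by omega)
    have h3 := h.2.2.1
    rw [rowCells, wordOf_cons, List.filter_cons]
    simp only [decide_eq_true_eq]
    split_ifs at h1 ⊢ with hc
    · rw [exchanges, h1, List.map_cons, crossingPipes, ← h2, ← h3, add_assoc]
    · exact h1

theorem exchanges_readCells {n : ℕ} {P : Finset (ℕ × ℕ)} (hP : IsPipeDream n P) (k : ℕ) :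
    exchanges 1 (wordOf P (readCells n k)) =
      ((readCells n k).filter (· ∈ P)).map (crossingPipes n P) := by
  induction k with
  | zero => rfl
  | succ k ih =>
    rw [readCells, wordOf_append, exchanges_append, ih,
      exchanges_rowCells hP n (isFront_readCells implements_mulAdj hP le_rfl k),
      List.filter_append, List.map_append]

theorem isReduced_iff {n : ℕ} {P : Finset (ℕ × ℕ)} (hP : IsPipeDream n P) :
    IsReduced n P ↔
      ascents 1 (wordOf P (readCells n n)) = (wordOf P (readCells n n)).length := by
  have h1 : ∀ x, x ∉ inversions (1 : Perm ℕ) := by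
    rintro x ⟨k, l, h1, h2, -⟩
    exact h1.not_gt h2
  have h2 : ∀ c, c ∈ (readCells n n).filter (· ∈ P) ↔ c ∈ P := by
    intro c
    rw [List.mem_filter, mem_readCells, decide_eq_true_eq, and_iff_right_iff_imp]
    intro hc
    have := hP c hc
    omega
  rw [ascents_eq_length_iff, exchanges_readCells hP,
    List.nodup_map_iff_inj_on ((nodup_readCells n n).filter _)]
  simp only [h1, not_false_eq_true, implies_true, and_true, h2]
  rfl

-- Forced crossings and membership in `allPipes`.

theorem north_sorted_le {n : ℕ} {P : Finset (ℕ × ℕ)} {r c : ℕ} (h : ∀ a < r, (a, c) ∈ P) :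
    north sorted n P r c ≤ c := by
  induction r with
  | zero => rw [north_zero]
  | succ r ih =>
    rw [north_succ, if_pos (h r (by omega))]
    exact (min_le_left _ _).trans (ih fun a ha => h a (by omega))

/-- The bump at `(r, c)` sends out a label at most `c`; further left, each crossing takes a maximum
with a label from the top that is at most its own column. A large exit label therefore forces a
crossing. -/
theorem west_sorted_le {n : ℕ} {P : Finset (ℕ × ℕ)} (hP : IsPipeDream n P) {r c : ℕ}
    (h : ∀ a ≤ r, ∀ b ≤ c, (a, b) ≠ (r, c) → (a, b) ∈ P) (hrc : (r, c) ∉ P) :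
    west sorted n P r 0 ≤ c := by
  have key : ∀ d ≤ c, west sorted n P r (c - d) ≤ c := by
    intro d
    induction d with
    | zero =>
      intro _
      rw [Nat.sub_zero, west_eq hP, if_neg hrc]
      exact north_sorted_le fun a ha => h a ha.le c le_rfl (by simp; omega)
    | succ d ih =>
      intro hd
      have h1 : c - (d + 1) + 1 = c - d := by omega
      rw [west_eq hP, if_pos (h r le_rfl _ (by omega) (by simp; omega)), h1]
      refine max_le (le_trans (north_sorted_le fun a ha => ?_) (Nat.sub_le c (d + 1)))
        (ih (by omega))
      exact h a ha.le _ (by omega) (by simp; omega)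
  simpa using key c le_rfl

theorem mem_allPipes_iff {w : Perm ℕ} {P : Finset (ℕ × ℕ)} :
    P ∈ allPipes w ↔ ∃ m, IsPipeDream m P ∧ ∀ n, m ≤ n → demazure n P = w := by
  constructor
  · rintro ⟨m, h1, h2, h3⟩
    exact ⟨m, h2, fun n hn => (hasPermutation_iff h2 hn h1).1 h3⟩
  · rintro ⟨m, h1, h2⟩
    have h3 := h2 m le_rfl
    have h4 : MemS m w := h3 ▸ demazure_memS h1
    exact ⟨m, h4, h1, (hasPermutation_iff h1 le_rfl h4).2 h3⟩

theorem mem_allPipes_of_demazure_eq {w : Perm ℕ} {P : Finset (ℕ × ℕ)} {m : ℕ}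
    (h : IsPipeDream m P) (hw : demazure m P = w) : P ∈ allPipes w :=
  have h' : MemS m w := hw ▸ demazure_memS h
  ⟨m, h', h, (hasPermutation_iff h le_rfl h').2 hw⟩

theorem mem_reducedPipes_iff {w : Perm ℕ} {P : Finset (ℕ × ℕ)} {n : ℕ} (hP : IsPipeDream n P) :
    P ∈ reducedPipes w ↔ P ∈ allPipes w ∧
      ascents 1 (wordOf P (readCells n n)) = (wordOf P (readCells n n)).length := by
  rw [← isReduced_iff hP]
  constructor
  · rintro ⟨m, h1, h2, h3, h4⟩
    exact ⟨⟨m, h1, h2, h3⟩, (isReduced_congr h2 hP).1 h4⟩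
  · rintro ⟨⟨m, h1, h2, h3⟩, h4⟩
    exact ⟨m, h1, h2, h3, (isReduced_congr h2 hP).2 h4⟩

theorem eq_of_mem_allPipes {u v : Perm ℕ} {P : Finset (ℕ × ℕ)} (hu : P ∈ allPipes u)
    (hv : P ∈ allPipes v) : u = v := by
  obtain ⟨m, -, h1⟩ := mem_allPipes_iff.1 hu
  obtain ⟨n, -, h2⟩ := mem_allPipes_iff.1 hv
  rw [← h1 _ (le_max_left m n), h2 _ (le_max_right m n)]

/-- A pipe dream of `w` has crossings in all Young diagrams contained in the Rothe diagram of `w`;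
here this is stated for rectangles. -/
theorem mem_of_mem_allPipes {w : Perm ℕ} {P : Finset (ℕ × ℕ)} (hP : P ∈ allPipes w) {a b : ℕ}
    (h : ∀ a' ≤ a, b < w a') : ∀ s a' b', a' + b' = s → a' ≤ a → b' ≤ b → (a', b') ∈ P := by
  intro s
  induction s using Nat.strong_induction_on with
  | _ s ih =>
    rintro a' b' rfl ha hb
    by_contra hc
    obtain ⟨m, h1, h2⟩ := mem_allPipes_iff.1 hP
    have h3 := west_sorted_le h1 (r := a') (c := b') (fun x hx y hy hne =>
      ih (x + y) (by
        by_contra! hlt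
        exact hne (Prod.ext (by simp only; omega) (by simp only; omega))) x y rfl
          (by omega) (by omega)) hc
    have h4 := demazure_apply h1 (le_max_left m (a' + 1)) (k := a')
      (lt_of_lt_of_le (Nat.lt_succ_self _) (le_max_right _ _))
    rw [h2 _ (le_max_left _ _)] at h4
    have := h a' ha
    omega

-- The effect of inserting one crossing.

theorem SwapChain.foldl_act {i : ℕ} (W : List ℕ) (hW : ∀ p ∈ W, i < p) :
    ∀ {B k : ℕ} {v u : Perm ℕ}, SwapChain i B k v u → ∃ B' k',
      SwapChain i B' k' (W.foldl act v) (W.foldl act u) ∧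
        k' + ascents v W = k + ascents u W := by
  induction W with
  | nil => exact fun {B k v u} h => ⟨B, k, h, rfl⟩
  | cons p W ih =>
    intro B k v u h
    rw [List.forall_mem_cons] at hW
    -- Raising the bound past `p + 1` makes the side condition of `act_act` vacuous.
    obtain ⟨k₁, h₁, e₁⟩ := (h.mono (Nat.le_add_right B (p + 2))).act_act hW.1 (by omega)
    obtain ⟨B₂, k₂, h₂, e₂⟩ := ih hW.2 h₁
    refine ⟨B₂, k₂, h₂, ?_⟩
    simp only [ascents]
    omega

/-- Each crossing meets an ascent, with or without the swap, and carries the letter of the dot one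
position up; conjugation thus moves `swap (i + c) a` to `swap i a`. -/
theorem foldl_act_mul_swap {i a : ℕ} {P : Finset (ℕ × ℕ)} (c : ℕ) : ∀ {v : Perm ℕ},
    (∀ b < c, (i, b) ∈ P) → (∀ b < c, v (i + b) < v (i + c)) → a ∈ phi (i + c) v →
    (wordOf P (rowCells i c)).foldl act (v * swap (i + c) a) =
        (wordOf P (rowCells i c)).foldl act v * swap i a ∧
      a ∈ phi i ((wordOf P (rowCells i c)).foldl act v) ∧
      (wordOf P (rowCells i c)).foldl act v i = v (i + c) ∧
      ascents (v * swap (i + c) a) (wordOf P (rowCells i c)) =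
        ascents v (wordOf P (rowCells i c)) := by
  induction c with
  | zero => exact fun _ _ h => ⟨rfl, h, rfl, rfl⟩
  | succ c ih =>
    intro v hP hv ha
    have ha' := mem_phi_iff.1 ha
    have h1 : v (i + c) < v (i + c + 1) := hv c (by omega)
    have h2 : (v * swap (i + (c + 1)) a) (i + c) < (v * swap (i + (c + 1)) a) (i + c + 1) := by
      simp only [mul_swap_apply]
      grind
    have h3 : act (v * swap (i + (c + 1)) a) (i + c) = act v (i + c) * swap (i + c) a := by
      rw [act_of_lt h1, act_of_lt h2]
      ext k
      simp only [mul_swap_apply]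
      grind
    have h4 : ∀ k, act v (i + c) k =
        if k = i + c then v (i + c + 1) else if k = i + c + 1 then v (i + c) else v k := fun k => by
      rw [act_of_lt h1, mul_swap_apply]
    obtain ⟨e1, e2, e3, e4⟩ := ih (v := act v (i + c)) (fun b hb => hP b (by omega)) (fun b hb => by
        rw [h4, h4, if_neg (by omega), if_neg (by omega), if_pos rfl]
        exact hv b (by omega)) (by
      rw [mem_phi_iff]
      simp only [h4]
      refine ⟨by omega, by grind, fun b hb hb' => ?_⟩
      have := ha'.2.2 b
      grind)
    rw [rowCells, wordOf_cons, if_pos (hP c (by omega)), List.foldl_cons, List.foldl_cons, ascents,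
      ascents, h3, e1, e4, asc_of_lt h1, asc_of_lt h2]
    refine ⟨rfl, e2, ?_, rfl⟩
    rw [e3, h4, if_pos rfl]
    rfl

theorem wordOf_insert {P : Finset (ℕ × ℕ)} {x : ℕ × ℕ} {L : List (ℕ × ℕ)} (h : x ∉ L) :
    wordOf (insert x P) L = wordOf P L := by
  unfold wordOf
  congr 1
  refine List.filter_congr fun y hy => ?_
  have : y ≠ x := fun h' => h (h' ▸ hy)
  simp [this]

theorem exists_readCells_eq_append (m i d : ℕ) : ∃ L, readCells m (i + 1 + d) =
    readCells m i ++ (rowCells i m ++ L) ∧ ∀ x ∈ L, i < x.1 := by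
  induction d with
  | zero => exact ⟨[], by simp [readCells], by simp⟩
  | succ d ih =>
    obtain ⟨L, h1, h2⟩ := ih
    refine ⟨L ++ rowCells (i + 1 + d) m, ?_, ?_⟩
    · rw [← add_assoc, readCells, h1]
      simp
    · intro x hx
      rcases List.mem_append.1 hx with hx | hx
      · exact h2 x hx
      · rw [mem_rowCells] at hx
        omega

theorem apply_eq_of_apply_le {v : Perm ℕ} {i j : ℕ} (h : ∀ b ≤ j, v (i + b) ≤ b) :
    ∀ b ≤ j, v (i + b) = b := by
  intro b
  induction b using Nat.strong_induction_on with
  | _ b ih =>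
    intro hb
    by_contra hne
    have h1 := h b hb
    have h2 := ih (v (i + b)) (by omega) (by omega)
    have h3 := v.injective h2
    omega

/-- The effect of a new crossing in the corner of a rectangle that is otherwise filled with
crossings. -/
theorem exists_swapChain_insert {n i j : ℕ} {P : Finset (ℕ × ℕ)}
    (hP : IsPipeDream n (insert (i, j) P)) (hij : (i, j) ∉ P)
    (hrect : ∀ a ≤ i, ∀ b ≤ j, (a, b) ≠ (i, j) → (a, b) ∈ P) :
    demazure n P i = j ∧ j < demazure n (insert (i, j) P) i ∧
      (wordOf (insert (i, j) P) (readCells n n)).length =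
        (wordOf P (readCells n n)).length + 1 ∧
      ∃ B k, SwapChain i B k (demazure n P) (demazure n (insert (i, j) P)) ∧
        k + ascents 1 (wordOf P (readCells n n)) =
          ascents 1 (wordOf (insert (i, j) P) (readCells n n)) := by
  have hn : i + j + 2 ≤ n := hP _ (Finset.mem_insert_self _ _)
  have hP' : IsPipeDream n P := fun c hc => hP c (Finset.mem_insert_of_mem hc)
  obtain ⟨L, hL, hLi⟩ := exists_readCells_eq_append n i (n - (i + 1))
  rw [show i + 1 + (n - (i + 1)) = n by omega] at hL
  have hfront := isFront_readCells implements_act hP' le_rfl i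
  obtain ⟨A, hA, hAj, hfront⟩ := IsFront.row_append implements_act hP' (n - (j + 1)) (j + 1)
    (r := i) (v := (wordOf P (readCells n i)).foldl act 1)
    (by rwa [show j + 1 + (n - (j + 1)) = n by omega])
  rw [show j + 1 + (n - (j + 1)) = n by omega, rowCells] at hA
  rw [hA] at hL
  set v := (wordOf P A).foldl act ((wordOf P (readCells n i)).foldl act 1) with hv
  have hvb : ∀ b ≤ j, v (i + b) = b := apply_eq_of_apply_le fun b hb => by
    rw [hfront.2.1 b (by omega)]
    exact north_sorted_le fun a ha => hrect a ha.le b hb (by simp; omega)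
  -- The letters `0, …, j` are already used in positions `i, …, i + j`.
  have hvj : j < v (i + j + 1) := by
    by_contra! hc
    have := v.injective (hvb _ hc)
    omega
  have hvj' : v (i + j) < v (i + j + 1) := by rwa [hvb j le_rfl]
  have hphi : i + j + 1 ∈ phi (i + j) v := mem_phi_iff.2 ⟨by omega, hvj', fun a _ _ => by omega⟩
  obtain ⟨e1, e2, e3, e4⟩ := foldl_act_mul_swap (i := i) (P := P) j (v := v)
    (fun b hb => hrect i le_rfl b hb.le (by simp; omega))
    (fun b hb => by rw [hvb b hb.le, hvb j le_rfl]; exact hb) hphi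
  have hW : ∀ p ∈ wordOf P L, i < p := by
    intro p hp
    simp only [wordOf, List.mem_map, List.mem_filter] at hp
    obtain ⟨c, ⟨hc, -⟩, rfl⟩ := hp
    exact (hLi c hc).trans_le (Nat.le_add_right _ _)
  set v₂ := (wordOf P (rowCells i j)).foldl act v with hv₂
  obtain ⟨B, k, hk, hk'⟩ := SwapChain.foldl_act _ hW
    (SwapChain.cons (Nat.lt_succ_self _) e2 (SwapChain.nil _ (v₂ * swap i (i + j + 1))))
  have w1 : wordOf P (readCells n n) = wordOf P (readCells n i) ++ (wordOf P A ++
      (wordOf P (rowCells i j) ++ wordOf P L)) := by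
    rw [hL]
    simp [wordOf_append, wordOf_cons, hij]
  have w2 : wordOf (insert (i, j) P) (readCells n n) = wordOf P (readCells n i) ++ (wordOf P A ++
      ((i + j) :: (wordOf P (rowCells i j) ++ wordOf P L))) := by
    rw [hL]
    simp only [wordOf_append, wordOf_cons, List.cons_append, List.append_assoc,
      Finset.mem_insert_self, if_true]
    rw [wordOf_insert (L := readCells n i) (by simp [mem_readCells]),
      wordOf_insert (L := A) (fun h => by have := (hAj _ h).1; simp only at this; omega),
      wordOf_insert (L := rowCells i j) (by simp [mem_rowCells]),
      wordOf_insert (L := L) (fun h => (hLi _ h).false)]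
  have d1 : demazure n P = (wordOf P L).foldl act v₂ := by
    simp only [demazure, w1, List.foldl_append, hv₂, hv]
  have d2 : demazure n (insert (i, j) P) =
      (wordOf P L).foldl act (v₂ * swap i (i + j + 1)) := by
    rw [← e1, ← act_of_lt hvj']
    simp only [demazure, w2, List.foldl_append, List.foldl_cons, hv]
  have hne : ∀ p ∈ wordOf P L, i ≠ p ∧ i ≠ p + 1 := fun p hp => by
    have := hW p hp
    omega
  have hd1 : demazure n P i = j := by
    rw [d1, foldl_act_apply_of_forall_ne _ hne, e3, hvb j le_rfl]
  refine ⟨hd1, ?_, ?_, B, k, ?_, ?_⟩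
  · rw [d2, foldl_act_apply_of_forall_ne _ hne, mul_swap_apply, if_pos rfl]
    have := (mem_phi_iff.1 e2).2.1
    rwa [e3, hvb j le_rfl] at this
  · rw [w1, w2]
    simp only [List.length_append, List.length_cons]
    omega
  · rwa [d1, d2]
  · rw [w1, w2]
    simp only [ascents_append, ascents]
    rw [← hv, ← hv₂, act_of_lt hvj', asc_of_lt hvj', e1, e4]
    omega

-- Addable cells and the bijection.

/-- Addable cells of the dominant part are dots, and lie on the boundary of the dominant part. -/
theorem apply_of_isAddable {w : Perm ℕ} {μ : YoungDiagram}
    (hμ : IsDominantPart (rotheDiagram w) μ) {i j : ℕ} (hij : IsAddable μ i j) :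
    w i = j ∧ ∀ a < i, j < w a := by
  obtain ⟨hij, hi, hj⟩ := hij
  have hD : ∀ {a b}, (a, b) ∈ μ → b < w a ∧ a < w.symm b := fun {a b} h =>
    ⟨(hμ.1 h).1 a rfl, (hμ.1 h).2 _ (w.apply_symm_apply b)⟩
  have hcol : ∀ a < i, (a, j) ∈ μ := fun a ha => μ.up_left_mem (by omega) le_rfl (hi (by omega))
  have hrow : ∀ b < j, (i, b) ∈ μ := fun b hb => μ.up_left_mem le_rfl (by omega) (hj (by omega))
  refine ⟨?_, fun a ha => (hD (hcol a ha)).1⟩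
  have h1 : j ≤ w i := by
    by_contra! hc
    have := (hD (hrow _ hc)).1
    omega
  have h2 : i ≤ w.symm j := by
    by_contra! hc
    have := (hD (hcol _ hc)).2
    omega
  by_contra hne
  have h3 : i ≠ w.symm j := fun h => hne (by rw [h, apply_symm_apply])
  -- Unless `w i = j`, the cell `(i, j)` lies in the Rothe diagram, and adding it to `μ` contradicts
  -- maximality.
  let ν : YoungDiagram := ⟨insert (i, j) μ.cells, by
    rintro ⟨a, b⟩ ⟨c, d⟩ ⟨h4, h5⟩ h6
    simp only [Finset.coe_insert, Set.mem_insert_iff, Prod.mk.injEq] at h4 h5 h6 ⊢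
    rcases h6 with ⟨rfl, rfl⟩ | h6
    · rcases h4.lt_or_eq with h4 | rfl
      · exact .inr (μ.up_left_mem le_rfl h5 (hcol _ h4))
      · rcases h5.lt_or_eq with h5 | rfl
        · exact .inr (hrow _ h5)
        · exact .inl ⟨rfl, rfl⟩
    · exact .inr (μ.isLowerSet ⟨h4, h5⟩ h6)⟩
  have hν : ν ≤ μ := hμ.2 (by
    intro x hx
    rcases Finset.mem_insert.1 (Finset.mem_coe.1 hx) with rfl | hx
    · refine ⟨?_, ?_⟩
      · rintro a rfl
        simp only
        omega
      · intro a ha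
        have : a = w.symm j := w.eq_symm_apply.2 ha
        simp only
        omega
    · exact hμ.1 hx)
  exact hij (hν (Finset.mem_insert_self (i, j) μ.cells))

section Bijection

variable {w : Perm ℕ} {i j : ℕ} {P : Finset (ℕ × ℕ)}

theorem mem_of_isAddable (hi : w i = j) (hlt : ∀ a < i, j < w a) (hP : P ∈ allPipes w) :
    ∀ a ≤ i, ∀ b ≤ j, (a, b) ≠ (i, j) → (a, b) ∈ P := by
  intro a ha b hb hne
  rcases ha.lt_or_eq with ha | rfl
  · exact mem_of_mem_allPipes hP (fun a' h => (hb.trans_lt (hlt a' (by omega)))) _ a b rfl le_rfl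
      le_rfl
  · have hb : b < j := lt_of_le_of_ne hb fun h => hne (by rw [h])
    refine mem_of_mem_allPipes hP (fun a' h => ?_) _ a b rfl le_rfl le_rfl
    rcases h.lt_or_eq with h | rfl
    · exact hb.trans (hlt a' h)
    · omega

theorem notMem_of_isAddable (hi : w i = j) (hlt : ∀ a < i, j < w a) (hP : P ∈ allPipes w) :
    (i, j) ∉ P := by
  intro hc
  obtain ⟨m, h1, h2⟩ := mem_allPipes_iff.1 hP
  have h3 := mem_of_isAddable hi hlt hP
  -- Erasing and reinserting the supposed crossing would give `j < w i`.
  obtain ⟨-, h4, -⟩ := exists_swapChain_insert (P := P.erase (i, j)) (n := m)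
    (by rwa [Finset.insert_erase hc]) (Finset.notMem_erase _ _)
    (fun a ha b hb hne => Finset.mem_erase.2 ⟨hne, h3 a ha b hb hne⟩)
  rw [Finset.insert_erase hc, h2 m le_rfl] at h4
  omega

theorem exists_mem_allPipes_insert (hi : w i = j) (hlt : ∀ a < i, j < w a) (hP : P ∈ allPipes w) :
    ∃ n B k u, IsPipeDream n (insert (i, j) P) ∧ SwapChain i B k w u ∧ k ≠ 0 ∧
      insert (i, j) P ∈ allPipes u ∧
      k + ascents 1 (wordOf P (readCells n n)) =
        ascents 1 (wordOf (insert (i, j) P) (readCells n n)) ∧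
      (wordOf (insert (i, j) P) (readCells n n)).length =
        (wordOf P (readCells n n)).length + 1 := by
  obtain ⟨m, h1, h2⟩ := mem_allPipes_iff.1 hP
  -- The size is enlarged so that `(i, j)` fits into the staircase.
  have h3 : IsPipeDream (m + (i + j + 2)) (insert (i, j) P) := by
    intro c hc
    rcases Finset.mem_insert.1 hc with rfl | hc
    · simp only
      omega
    · have := h1 c hc
      omega
  obtain ⟨h4, h5, h6, B, k, h7, h8⟩ := exists_swapChain_insert h3 (notMem_of_isAddable hi hlt hP)
    (mem_of_isAddable hi hlt hP)
  rw [h2 _ (Nat.le_add_right _ _)] at h7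
  refine ⟨_, B, k, _, h3, h7, ?_, mem_allPipes_of_demazure_eq h3 rfl, h8, h6⟩
  rintro rfl
  cases h7
  omega

theorem exists_mem_allPipes_erase (hi : w i = j) (hlt : ∀ a < i, j < w a) {u : Perm ℕ} {B k : ℕ}
    (h : SwapChain i B k w u) (hk : k ≠ 0) (hP : P ∈ allPipes u) :
    (i, j) ∈ P ∧ P.erase (i, j) ∈ allPipes w ∧ ∃ n, IsPipeDream n P ∧
      k + ascents 1 (wordOf (P.erase (i, j)) (readCells n n)) =
        ascents 1 (wordOf P (readCells n n)) ∧
      (wordOf P (readCells n n)).length =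
        (wordOf (P.erase (i, j)) (readCells n n)).length + 1 := by
  have h1 : ∀ a ≤ i, ∀ b ≤ j, (a, b) ∈ P := fun a ha b hb => by
    refine mem_of_mem_allPipes hP (a := i) (b := j) (fun a' h' => ?_) _ a b rfl ha hb
    rcases h'.lt_or_eq with h' | rfl
    · rw [h.apply_of_lt a' h']
      exact hlt a' h'
    · exact hi ▸ h.apply_lt hk
  have hc := h1 i le_rfl j le_rfl
  obtain ⟨m, h2, h3⟩ := mem_allPipes_iff.1 hP
  obtain ⟨h4, -, h5, B', k', h6, h7⟩ := exists_swapChain_insert (P := P.erase (i, j)) (n := m)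
    (by rwa [Finset.insert_erase hc]) (Finset.notMem_erase _ _)
    (fun a ha b hb hne => Finset.mem_erase.2 ⟨hne, h1 a ha b hb⟩)
  rw [Finset.insert_erase hc] at h5 h6 h7
  rw [h3 m le_rfl] at h6
  obtain ⟨h8, rfl⟩ := h.unique h6 (h4.trans hi.symm)
  exact ⟨hc, mem_allPipes_of_demazure_eq (fun c hc => h2 c (Finset.mem_of_mem_erase hc)) h8,
    m, h2, h7, h5⟩

theorem mem_PhiBar_iff {u : Perm ℕ} : u ∈ PhiBar i w ↔ ∃ B k, SwapChain i B k w u ∧ k ≠ 0 := by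
  constructor
  · rintro ⟨U, h1, h2, rfl⟩
    exact ⟨U.sup id + 1, U.card, swapChain_mulSwaps U h2 fun a ha =>
      Nat.lt_succ_of_le (Finset.le_sup (f := id) ha), Finset.card_ne_zero.2 h1⟩
  · rintro ⟨B, k, h, hk⟩
    obtain ⟨U, h1, h2, -, h3⟩ := h.exists_finset
    exact ⟨U, Finset.card_ne_zero.1 (h1 ▸ hk), h2, h3⟩

theorem mem_Phi_iff {u : Perm ℕ} : u ∈ Phi i w ↔ ∃ B, SwapChain i B 1 w u := by
  constructor
  · rintro ⟨k, hk, rfl⟩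
    exact ⟨k + 1, .cons (Nat.lt_succ_self k) hk (.nil _ _)⟩
  · rintro ⟨B, h⟩
    cases h with
    | @cons _ a _ _ _ ha hv h =>
      cases h
      exact ⟨a, hv, rfl⟩

theorem insert_injOn {S : Set (Finset (ℕ × ℕ))} (h : ∀ P ∈ S, (i, j) ∉ P) :
    S.InjOn fun P : Finset (ℕ × ℕ) => insert (i, j) P := by
  intro P hP Q hQ hPQ
  simp only at hPQ
  rw [← Finset.erase_insert (h P hP), hPQ, Finset.erase_insert (h Q hQ)]

end Bijection

end PipeDream

theorem mainTheorem8 (w : Equiv.Perm ℕ) (hw : PipeDream.IsFinitary w)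
    (μ : YoungDiagram) (hμ : PipeDream.IsDominantPart (PipeDream.rotheDiagram w) μ)
    (i j : ℕ) (hij : PipeDream.IsAddable μ i j) :
    ((PipeDream.PhiBar i w).PairwiseDisjoint PipeDream.allPipes ∧
      Set.BijOn (fun P : Finset (ℕ × ℕ) => insert (i, j) P) (PipeDream.allPipes w)
        (⋃ u ∈ PipeDream.PhiBar i w, PipeDream.allPipes u)) ∧
    ((PipeDream.Phi i w).PairwiseDisjoint PipeDream.reducedPipes ∧
      Set.BijOn (fun P : Finset (ℕ × ℕ) => insert (i, j) P) (PipeDream.reducedPipes w)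
        (⋃ u ∈ PipeDream.Phi i w, PipeDream.reducedPipes u)) := by
  open PipeDream in
  obtain ⟨hi, hlt⟩ := apply_of_isAddable hμ hij
  have hsub : ∀ u, reducedPipes u ⊆ allPipes u := fun u P ⟨n, h1, h2, h3, _⟩ => ⟨n, h1, h2, h3⟩
  refine ⟨⟨?_, ?_, ?_, ?_⟩, ?_, ?_, ?_, ?_⟩
  · exact fun u _ v _ huv => Set.disjoint_left.2 fun P hu hv => huv (eq_of_mem_allPipes hu hv)
  · intro P hP
    obtain ⟨n, B, k, u, -, h1, h2, h3, -⟩ := exists_mem_allPipes_insert hi hlt hP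
    exact Set.mem_biUnion (mem_PhiBar_iff.2 ⟨B, k, h1, h2⟩) h3
  · exact insert_injOn fun P hP => notMem_of_isAddable hi hlt hP
  · intro P hP
    obtain ⟨u, hu, hP⟩ := Set.mem_iUnion₂.1 hP
    obtain ⟨B, k, h1, h2⟩ := mem_PhiBar_iff.1 hu
    obtain ⟨h3, h4, -⟩ := exists_mem_allPipes_erase hi hlt h1 h2 hP
    exact ⟨_, h4, Finset.insert_erase h3⟩
  · exact fun u _ v _ huv => Set.disjoint_left.2 fun P hu hv =>
      huv (eq_of_mem_allPipes (hsub u hu) (hsub v hv))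
  · intro P hP
    obtain ⟨n, B, k, u, h1, h2, h3, h4, h5, h6⟩ := exists_mem_allPipes_insert hi hlt (hsub w hP)
    have h7 := ((mem_reducedPipes_iff fun c hc => h1 c (Finset.mem_insert_of_mem hc)).1 hP).2
    have h8 := ascents_le (wordOf (insert (i, j) P) (readCells n n)) 1
    -- The word of `P` has only ascents, so `k` plus its length is at most the length of the new
    -- word, which is one more; and `k ≠ 0`.
    obtain rfl : k = 1 := by omega
    exact Set.mem_biUnion (mem_Phi_iff.2 ⟨B, h2⟩) ((mem_reducedPipes_iff h1).2 ⟨h4, by omega⟩)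
  · exact insert_injOn fun P hP => notMem_of_isAddable hi hlt (hsub w hP)
  · intro P hP
    obtain ⟨u, hu, hP⟩ := Set.mem_iUnion₂.1 hP
    obtain ⟨B, h1⟩ := mem_Phi_iff.1 hu
    obtain ⟨h3, h4, n, h5, h6, h7⟩ := exists_mem_allPipes_erase hi hlt h1 one_ne_zero (hsub u hP)
    have h8 := ((mem_reducedPipes_iff h5).1 hP).2
    exact ⟨_, (mem_reducedPipes_iff fun c hc => h5 c (Finset.mem_of_mem_erase hc)).2
      ⟨h4, by omega⟩, Finset.insert_erase h3⟩
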